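/- Let $\mathbb S^n$ be the space of real symmetric $n\times n$ matrices, $\mathbb S^n_+$ and $\mathbb S^n_{++}$ the sets of positive semidefinite and positive definite matrices in it, and $\preceq$ the Löwner order on $\mathbb S^n$ ($A\preceq B$ iff $B-A\in\mathbb S^n_+$). All matrix spaces carry the Frobenius inner product $\langle X,Y\rangle=\operatorname{tr}(X^TY)$; $\operatorname{rge}$ denotes the range (column space) and $V^\dagger$ the Moore–Penrose pseudoinverse. For a set $S\subset\mathbb S^n$ let $\sigma_S(W)=\sup_{V\in S}\langle V,W\rangle$. For $f:\mathbb R^{n\times m}\to\overline{\mathbb R}$ let $\operatorname{dom} f=\{X: f(X)<+\infty\}$, $f^*(X)=\sup_{Y}\{\langle X,Y\rangle-f(Y)\}$, $\partial f(\bar X)=\{Y: f(X)\ge f(\bar X)+\langle Y,X-\bar X\rangle\ \text{for all } X\}$ for $\bar X\in\operatorname{dom} f$ and $\partial f(\bar X)=\emptyset$ otherwise, and $\operatorname{dom}\partial f=\{X:\partial f(X)\neq\emptyset\}$. Let $\mathcal V\subset\mathbb S^n$ be closed and convex, and let $\Phi_{\mathcal V}:\mathbb R^{n\times m}\to\overline{\mathbb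 R}$ be the variational Gram function $$\Phi_{\mathcal V}(Y)=\tfrac12\,\sigma_{\mathcal V\cap\mathbb S^n_+}(YY^T).$$ (a) If $\mathcal V\cap\mathbb S^n_{++}\neq\emptyset$, then $\operatorname{dom}\partial\Phi_{\mathcal V}^*=\operatorname{dom}\Phi_{\mathcal V}^*$ and, for all $\bar X\in\mathbb R^{n\times m}$, $$\partial\Phi_{\mathcal V}^*(\bar X)=\operatorname*{argmax}_{Y\in\mathbb R^{n\times m}}\Big\{\langle\bar X,Y\rangle-\inf_{T\in\mathbb S^n:\ \frac12YY^T\preceq T}\sigma_{\mathcal V\cap\mathbb S^n_+}(T)\Big\}.$$ (b) If $\mathcal V\cap\mathbb S^n_+$ is nonempty and bounded, then $\operatorname{dom}\partial\Phi_{\mathcal V}^*=\operatorname{dom}\Phi_{\mathcal V}^*$ and, for all $\bar X\in\operatorname{dom}\Phi_{\mathcal V}^*$, $$\partial\Phi_{\mathcal V}^*(\bar X)=\Big\{\bar Y:\ \exists\,\bar V\in\mathcal V\cap\mathbb S^n_+ \text{ with } \operatorname{rge}\bar X\subset\operatorname{rge}\bar V \text{ and } \Phi_{\mathcal V}^*(\bar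 X)=\tfrac12\operatorname{tr}(\bar X^T\bar V^\dagger\bar X)=\langle\bar X,\bar Y\rangle-\Phi_{\mathcal V}(\bar Y)\Big\}.$$ -/

import Mathlib

noncomputable section

namespace VGF

open Matrix

/-- The (Frobenius) inner product `⟨X, Y⟩ = tr (Xᵀ Y)` on real matrices. -/
def frob {k l : ℕ} (X Y : Matrix (Fin k) (Fin l) ℝ) : ℝ := (Xᵀ * Y).trace

/-- The four Penrose equations: `P` is a Moore-Penrose pseudoinverse of `A`. -/
structure IsMoorePenrose {k l : ℕ} (A : Matrix (Fin k) (Fin l) ℝ)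
    (P : Matrix (Fin l) (Fin k) ℝ) : Prop where
  mul_mul_left : A * P * A = A
  mul_mul_right : P * A * P = P
  symm_left : (A * P)ᵀ = A * P
  symm_right : (P * A)ᵀ = P * A

theorem IsMoorePenrose.unique {k l : ℕ} {A : Matrix (Fin k) (Fin l) ℝ}
    {P Q : Matrix (Fin l) (Fin k) ℝ} (hP : IsMoorePenrose A P) (hQ : IsMoorePenrose A Q) :
    P = Q := by
  have h1 : A * P = A * Q := by
    calc A * P = (A * P)ᵀ := hP.symm_left.symm
      _ = ((A * Q * A) * P)ᵀ := by rw [hQ.mul_mul_left]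
      _ = ((A * Q) * (A * P))ᵀ := by simp only [Matrix.mul_assoc]
      _ = (A * P) * (A * Q) := by rw [Matrix.transpose_mul, hP.symm_left, hQ.symm_left]
      _ = (A * P * A) * Q := by simp only [Matrix.mul_assoc]
      _ = A * Q := by rw [hP.mul_mul_left]
  have h2 : P * A = Q * A := by
    calc P * A = (P * A)ᵀ := hP.symm_right.symm
      _ = (P * (A * Q * A))ᵀ := by rw [hQ.mul_mul_left]
      _ = ((P * A) * (Q * A))ᵀ := by simp only [Matrix.mul_assoc]
      _ = (Q * A) * (P * A) := by rw [Matrix.transpose_mul, hP.symm_right, hQ.symm_right]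
      _ = Q * (A * P * A) := by simp only [Matrix.mul_assoc]
      _ = Q * A := by rw [hP.mul_mul_left]
  calc P = P * A * P := hP.mul_mul_right.symm
    _ = Q * (A * P) := by rw [h2, Matrix.mul_assoc]
    _ = Q * A * Q := by rw [h1, Matrix.mul_assoc]
    _ = Q := hQ.mul_mul_right

theorem exists_isMoorePenrose_of_isHermitian {k : ℕ} {G : Matrix (Fin k) (Fin k) ℝ}
    (hG : G.IsHermitian) : ∃ P, IsMoorePenrose G P ∧ Pᵀ = P := by
  set φ := Unitary.conjStarAlgAut ℝ (Matrix (Fin k) (Fin k) ℝ) hG.eigenvectorUnitary with hφ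
  set d : Fin k → ℝ := hG.eigenvalues
  have hGφ : G = φ (diagonal d) := hG.spectral_theorem
  have ht : ∀ e : Fin k → ℝ, (φ (diagonal e))ᵀ = φ (diagonal e) := by
    intro e
    have h : star (φ (diagonal e)) = φ (diagonal e) := by
      rw [← map_star, Matrix.star_eq_conjTranspose, Matrix.diagonal_conjTranspose, star_trivial]
    rwa [Matrix.star_eq_conjTranspose, Matrix.conjTranspose_eq_transpose_of_trivial] at h
  refine ⟨φ (diagonal fun i => (d i)⁻¹), ⟨?_, ?_, ?_, ?_⟩, ht _⟩ <;>
    rw [hGφ] <;> simp only [← map_mul, Matrix.diagonal_mul_diagonal, ht]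
  · congr 2
    funext i
    exact mul_inv_mul_cancel (d i)
  · congr 2
    funext i
    simpa using mul_inv_mul_cancel (d i)⁻¹

theorem exists_isMoorePenrose {k l : ℕ} (A : Matrix (Fin k) (Fin l) ℝ) :
    ∃ P, IsMoorePenrose A P := by
  obtain ⟨P, hP, hPt⟩ := exists_isMoorePenrose_of_isHermitian
    (G := Aᵀ * A) (by simpa using Matrix.isHermitian_conjTranspose_mul_self A)
  refine ⟨P * Aᵀ, ⟨?_, ?_, ?_, ?_⟩⟩
  · have h : Aᴴ * A * (P * (Aᵀ * A) - 1) = 0 := by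
      rw [Matrix.conjTranspose_eq_transpose_of_trivial, Matrix.mul_sub, ← Matrix.mul_assoc,
        hP.mul_mul_left, Matrix.mul_one, sub_self]
    rw [Matrix.conjTranspose_mul_self_mul_eq_zero, Matrix.mul_sub, Matrix.mul_one,
      sub_eq_zero] at h
    simpa only [Matrix.mul_assoc] using h
  · have h := congrArg (· * Aᵀ) hP.mul_mul_right
    simpa only [Matrix.mul_assoc] using h
  · simp only [Matrix.transpose_mul, Matrix.transpose_transpose, hPt, Matrix.mul_assoc]
  · simpa only [Matrix.mul_assoc] using hP.symm_right

/-- The Moore-Penrose pseudoinverse `A†` of a real matrix. -/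
def pinv {k l : ℕ} (A : Matrix (Fin k) (Fin l) ℝ) : Matrix (Fin l) (Fin k) ℝ :=
  (exists_isMoorePenrose A).choose

theorem pinv_spec {k l : ℕ} (A : Matrix (Fin k) (Fin l) ℝ) : IsMoorePenrose A (pinv A) :=
  (exists_isMoorePenrose A).choose_spec

/-- The range (column space) of a matrix. -/
def rge {k l : ℕ} (A : Matrix (Fin k) (Fin l) ℝ) : Submodule ℝ (Fin k → ℝ) :=
  LinearMap.range A.mulVecLin

/-- The support function `σ_S(W) = sup_{V ∈ S} ⟨V, W⟩`. -/
def supportFn {k l : ℕ} (S : Set (Matrix (Fin k) (Fin l) ℝ))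
    (W : Matrix (Fin k) (Fin l) ℝ) : EReal :=
  ⨆ V ∈ S, (frob V W : EReal)

/-- Boundedness of a set of matrices in the Frobenius norm. -/
def FrobBounded {k l : ℕ} (S : Set (Matrix (Fin k) (Fin l) ℝ)) : Prop :=
  ∃ C : ℝ, ∀ V ∈ S, Real.sqrt (frob V V) ≤ C

/-- `𝒱 ∩ 𝕊ⁿ₊`. -/
def psdPart {n : ℕ} (𝒱 : Set (Matrix (Fin n) (Fin n) ℝ)) : Set (Matrix (Fin n) (Fin n) ℝ) :=
  𝒱 ∩ {V | V.PosSemidef}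

/-- The variational Gram function `Φ_𝒱(Y) = ½ σ_{𝒱 ∩ 𝕊ⁿ₊}(Y Yᵀ)` on `ℝ^{n × m}`. -/
def Phi {n : ℕ} (𝒱 : Set (Matrix (Fin n) (Fin n) ℝ)) (m : ℕ)
    (Y : Matrix (Fin n) (Fin m) ℝ) : EReal :=
  ((1 / 2 : ℝ) : EReal) * supportFn (psdPart 𝒱) (Y * Yᵀ)

/-- The Fenchel conjugate `f*(y) = sup_x {⟨x, y⟩ - f(x)}`. -/
def conj {k l : ℕ} (f : Matrix (Fin k) (Fin l) ℝ → EReal)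
    (y : Matrix (Fin k) (Fin l) ℝ) : EReal :=
  ⨆ x, ((frob x y : EReal) - f x)

/-- The (effective) domain `{x | f x < +∞}`. -/
def dom {k l : ℕ} (f : Matrix (Fin k) (Fin l) ℝ → EReal) : Set (Matrix (Fin k) (Fin l) ℝ) :=
  {x | f x < ⊤}

/-- The convex subdifferential; it is empty outside `dom f`. -/
def subdiff {k l : ℕ} (f : Matrix (Fin k) (Fin l) ℝ → EReal)
    (x₀ : Matrix (Fin k) (Fin l) ℝ) : Set (Matrix (Fin k) (Fin l) ℝ) :=
  {v | x₀ ∈ dom f ∧ ∀ x, f x₀ + (frob v (x - x₀) : EReal) ≤ f x}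

/-- The domain `{x | ∂f(x) ≠ ∅}` of the subdifferential. -/
def domSubdiff {k l : ℕ} (f : Matrix (Fin k) (Fin l) ℝ → EReal) :
    Set (Matrix (Fin k) (Fin l) ℝ) :=
  {x | (subdiff f x).Nonempty}

/-- The set of global maximizers of `f`. -/
def argmax {k l : ℕ} (f : Matrix (Fin k) (Fin l) ℝ → EReal) :
    Set (Matrix (Fin k) (Fin l) ℝ) :=
  {y | IsMaxOn f Set.univ y}

/-- The infimum of `σ_{𝒱 ∩ 𝕊ⁿ₊}(T)` over symmetric `T` with `½ Y Yᵀ ⪯ T` (Löwner order;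
`T - ½ Y Yᵀ` being positive semidefinite includes its symmetry, hence that of `T`). -/
def infSupport {n : ℕ} (𝒱 : Set (Matrix (Fin n) (Fin n) ℝ)) {m : ℕ}
    (Y : Matrix (Fin n) (Fin m) ℝ) : EReal :=
  ⨅ T ∈ {T : Matrix (Fin n) (Fin n) ℝ | (T - (1 / 2 : ℝ) • (Y * Yᵀ)).PosSemidef},
    supportFn (psdPart 𝒱) T

end VGF

end

/-! Φ is the supremum of the convex quadratics q_V(Y) = ½⟨VY, Y⟩ (`quad`) over V ∈ 𝒱 ∩ 𝕊ⁿ₊. Since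
q_V*(VY) = q_V(Y), the values of Φ* at the points VY already recover Φ, so Y ∈ ∂Φ*(X) iff Φ*(X) is
finite and equals ⟨X, Y⟩ − Φ(Y) (`mem_subdiff_conj_Phi_iff`), without a biconjugation theorem. The
infimum in (a) is Φ(Y) itself (`infSupport_eq_Phi`), which gives the argmax formula.

For dom ∂Φ* = dom Φ* the supremum defining Φ*(X) must be attained. Convexity provides V₀ of smallest
kernel; Φ ignores components of Y in that kernel, finiteness of Φ*(X) excludes them from X, and
q_{V₀} is coercive on the rest (`subdiff_conj_Phi_nonempty`). Only convexity and 𝒱 ∩ 𝕊ⁿ₊ ≠ ∅ matter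
here, so this serves both (a) and (b).

In (b) the Fenchel equality makes X a subgradient at Y of a maximum over a compact convex set,
whence X = VY with V active at Y (`exists_active_eq_mul`); then XᵀV†X = YᵀVY and rge X ⊂ rge V. -/

namespace VGF

open Matrix

/-! ### Frobenius inner product -/

theorem frob_eq_sum {k l : ℕ} (X Y : Matrix (Fin k) (Fin l) ℝ) :
    frob X Y = ∑ i, ∑ j, X i j * Y i j := by
  simp only [frob, Matrix.trace, Matrix.diag, Matrix.mul_apply, Matrix.transpose_apply]
  exact Finset.sum_comm

theorem frob_comm {k l : ℕ} (X Y : Matrix (Fin k) (Fin l) ℝ) : frob X Y = frob Y X := by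
  simp only [frob_eq_sum, mul_comm]

theorem frob_add_left {k l : ℕ} (X Y Z : Matrix (Fin k) (Fin l) ℝ) :
    frob (X + Y) Z = frob X Z + frob Y Z := by
  simp [frob, Matrix.add_mul]

theorem frob_add_right {k l : ℕ} (X Y Z : Matrix (Fin k) (Fin l) ℝ) :
    frob X (Y + Z) = frob X Y + frob X Z := by
  simp [frob, Matrix.mul_add]

theorem frob_sub_right {k l : ℕ} (X Y Z : Matrix (Fin k) (Fin l) ℝ) :
    frob X (Y - Z) = frob X Y - frob X Z := by
  simp [frob, Matrix.mul_sub]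

theorem frob_smul_left {k l : ℕ} (c : ℝ) (X Y : Matrix (Fin k) (Fin l) ℝ) :
    frob (c • X) Y = c * frob X Y := by
  simp [frob]

theorem frob_smul_right {k l : ℕ} (c : ℝ) (X Y : Matrix (Fin k) (Fin l) ℝ) :
    frob X (c • Y) = c * frob X Y := by
  simp [frob]

@[simp] theorem frob_zero_right {k l : ℕ} (X : Matrix (Fin k) (Fin l) ℝ) : frob X 0 = 0 := by
  simp [frob]

@[simp] theorem frob_zero_left {k l : ℕ} (X : Matrix (Fin k) (Fin l) ℝ) : frob 0 X = 0 := by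
  simp [frob]

theorem sq_entry_le_frob_self {k l : ℕ} (X : Matrix (Fin k) (Fin l) ℝ) (i : Fin k) (j : Fin l) :
    X i j * X i j ≤ frob X X := by
  rw [frob_eq_sum]
  calc X i j * X i j ≤ ∑ j, X i j * X i j :=
        Finset.single_le_sum (f := fun j => X i j * X i j)
          (fun j _ => mul_self_nonneg _) (Finset.mem_univ j)
    _ ≤ _ := Finset.single_le_sum (f := fun i => ∑ j, X i j * X i j)
          (fun i _ => Finset.sum_nonneg fun j _ => mul_self_nonneg _) (Finset.mem_univ i)

theorem eq_zero_of_frob_self_nonpos {k l : ℕ} {X : Matrix (Fin k) (Fin l) ℝ}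
    (h : frob X X ≤ 0) : X = 0 := by
  ext i j
  exact mul_self_eq_zero.1 (le_antisymm ((sq_entry_le_frob_self X i j).trans h)
    (mul_self_nonneg _))

theorem frob_mul_left {k l p : ℕ} (A : Matrix (Fin k) (Fin p) ℝ) (Y : Matrix (Fin p) (Fin l) ℝ)
    (Z : Matrix (Fin k) (Fin l) ℝ) : frob (A * Y) Z = frob Y (Aᵀ * Z) := by
  simp [frob, Matrix.transpose_mul, Matrix.mul_assoc]

theorem frob_mul_transpose {n m : ℕ} (V : Matrix (Fin n) (Fin n) ℝ)
    (Y Z : Matrix (Fin n) (Fin m) ℝ) : frob V (Y * Zᵀ) = frob (V * Z) Y := by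
  simp only [frob, Matrix.transpose_mul]
  rw [← Matrix.mul_assoc, Matrix.trace_mul_comm, ← Matrix.mul_assoc]

theorem continuous_frob {k l : ℕ} {α : Type*} [TopologicalSpace α]
    {f g : α → Matrix (Fin k) (Fin l) ℝ} (hf : Continuous f) (hg : Continuous g) :
    Continuous fun a => frob (f a) (g a) := by
  unfold frob
  exact (hf.matrix_transpose.matrix_mul hg).matrix_trace

theorem isCompact_frob_self_le (k l : ℕ) (R : ℝ) :
    IsCompact {W : Matrix (Fin k) (Fin l) ℝ | frob W W ≤ R} := by
  have hK : IsCompact (Set.univ.pi fun _ : Fin k => Set.univ.pi fun _ : Fin l =>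
      Set.Icc (-√R) (√R)) :=
    isCompact_univ_pi fun _ => isCompact_univ_pi fun _ => isCompact_Icc
  refine IsCompact.of_isClosed_subset (X := Matrix (Fin k) (Fin l) ℝ) hK
    (isClosed_le (continuous_frob continuous_id continuous_id) continuous_const) ?_
  intro W hW i _ j _
  have h : W i j ^ 2 ≤ R := by
    rw [sq]
    exact (sq_entry_le_frob_self W i j).trans hW
  exact abs_le.1 (Real.abs_le_sqrt h)

/-! ### Quadratic forms and Φ as their supremum -/

/-- The quadratic form `½ ⟨V Y, Y⟩`. -/
noncomputable def quad {n m : ℕ} (V : Matrix (Fin n) (Fin n) ℝ) (Y : Matrix (Fin n) (Fin m) ℝ) :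
    ℝ := 1 / 2 * frob (V * Y) Y

theorem continuous_quad {n m : ℕ} {α : Type*} [TopologicalSpace α]
    {f : α → Matrix (Fin n) (Fin n) ℝ} {g : α → Matrix (Fin n) (Fin m) ℝ}
    (hf : Continuous f) (hg : Continuous g) : Continuous fun a => quad (f a) (g a) :=
  continuous_const.mul (continuous_frob (hf.matrix_mul hg) hg)

theorem quad_nonneg {n m : ℕ} {V : Matrix (Fin n) (Fin n) ℝ} (hV : V.PosSemidef)
    (Y : Matrix (Fin n) (Fin m) ℝ) : 0 ≤ quad V Y := by
  have h := (hV.conjTranspose_mul_mul_same Y).trace_nonneg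
  rw [Matrix.conjTranspose_eq_transpose_of_trivial, Matrix.mul_assoc] at h
  rw [quad, frob_comm, frob]
  linarith

@[simp] theorem quad_zero {n m : ℕ} (V : Matrix (Fin n) (Fin n) ℝ) :
    quad V (0 : Matrix (Fin n) (Fin m) ℝ) = 0 := by
  simp [quad]

theorem quad_add_smul {n m : ℕ} {V : Matrix (Fin n) (Fin n) ℝ} (hV : V.IsSymm)
    (Y D : Matrix (Fin n) (Fin m) ℝ) (t : ℝ) :
    quad V (Y + t • D) = quad V Y + t * frob (V * Y) D + t ^ 2 * quad V D := by
  have h : frob (V * D) Y = frob (V * Y) D := by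
    rw [frob_mul_left, hV.eq, frob_comm]
  simp only [quad, Matrix.mul_add, Matrix.mul_smul, frob_add_left, frob_add_right,
    frob_smul_left, frob_smul_right, h]
  ring

/-- Fenchel-Young inequality for a positive semidefinite quadratic form. -/
theorem frob_mul_le_quad_add_quad {n m : ℕ} {V : Matrix (Fin n) (Fin n) ℝ} (hV : V.PosSemidef)
    (hs : V.IsSymm) (Y Z : Matrix (Fin n) (Fin m) ℝ) :
    frob (V * Y) Z ≤ quad V Y + quad V Z := by
  have h := quad_nonneg hV (Y + (-1 : ℝ) • Z)
  rw [quad_add_smul hs] at h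
  linarith

theorem psdPart_isSymm {n : ℕ} {𝒱 : Set (Matrix (Fin n) (Fin n) ℝ)}
    {V : Matrix (Fin n) (Fin n) ℝ} (hV : V ∈ psdPart 𝒱) : V.IsSymm := by
  have h := hV.2.isHermitian
  rwa [Matrix.IsHermitian, Matrix.conjTranspose_eq_transpose_of_trivial] at h

theorem half_mul_le_iff {a b : EReal} :
    ((1 / 2 : ℝ) : EReal) * a ≤ b ↔ a ≤ ((2 : ℝ) : EReal) * b := by
  have key : ∀ {c : ℝ} {x y : EReal}, 0 ≤ c → x ≤ y → (c : EReal) * x ≤ c * y := fun hc h =>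
    mul_le_mul_of_nonneg_left h (EReal.coe_nonneg.2 hc)
  have e1 : ((2 : ℝ) : EReal) * ((1 / 2 : ℝ) : EReal) = 1 := by
    rw [← EReal.coe_mul]; norm_num
  constructor <;> intro h
  · have := key (c := 2) (by norm_num) h
    rwa [← mul_assoc, e1, one_mul] at this
  · have := key (c := 1 / 2) (by norm_num) h
    rwa [← mul_assoc, mul_comm ((1 / 2 : ℝ) : EReal) ((2 : ℝ) : EReal), e1, one_mul] at this

theorem Phi_le_iff {n m : ℕ} {𝒱 : Set (Matrix (Fin n) (Fin n) ℝ)} {Y : Matrix (Fin n) (Fin m) ℝ}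
    {a : EReal} : Phi 𝒱 m Y ≤ a ↔ ∀ V ∈ psdPart 𝒱, (quad V Y : EReal) ≤ a := by
  simp only [Phi, half_mul_le_iff, supportFn, iSup_le_iff, frob_mul_transpose, quad,
    EReal.coe_mul]

theorem quad_le_Phi {n m : ℕ} {𝒱 : Set (Matrix (Fin n) (Fin n) ℝ)}
    {V : Matrix (Fin n) (Fin n) ℝ} (hV : V ∈ psdPart 𝒱) (Y : Matrix (Fin n) (Fin m) ℝ) :
    (quad V Y : EReal) ≤ Phi 𝒱 m Y :=
  Phi_le_iff.1 le_rfl V hV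

theorem Phi_nonneg {n m : ℕ} {𝒱 : Set (Matrix (Fin n) (Fin n) ℝ)} (hne : (psdPart 𝒱).Nonempty)
    (Y : Matrix (Fin n) (Fin m) ℝ) : 0 ≤ Phi 𝒱 m Y := by
  obtain ⟨V, hV⟩ := hne
  exact (EReal.coe_nonneg.2 (quad_nonneg hV.2 Y)).trans (quad_le_Phi hV Y)

theorem Phi_zero {n m : ℕ} {𝒱 : Set (Matrix (Fin n) (Fin n) ℝ)} (hne : (psdPart 𝒱).Nonempty) :
    Phi 𝒱 m 0 = 0 :=
  le_antisymm (Phi_le_iff.2 fun V _ => by simp) (Phi_nonneg hne 0)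

open scoped MatrixOrder in
theorem _root_.Matrix.PosSemidef.exists_eq_star_mul_self {n : ℕ} {A : Matrix (Fin n) (Fin n) ℝ}
    (hA : A.PosSemidef) : ∃ B : Matrix (Fin n) (Fin n) ℝ, A = star B * B :=
  CStarAlgebra.nonneg_iff_eq_star_mul_self.1 hA.nonneg

/-- Factoring A = BᵀB turns the pairing into twice the quadratic form of V at Bᵀ. -/
theorem frob_nonneg_of_posSemidef {n : ℕ} {V A : Matrix (Fin n) (Fin n) ℝ} (hV : V.PosSemidef)
    (hA : A.PosSemidef) : 0 ≤ frob V A := by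
  obtain ⟨B, rfl⟩ := hA.exists_eq_star_mul_self
  have h : star B * B = Bᵀ * Bᵀᵀ := by
    rw [Matrix.star_eq_conjTranspose, Matrix.conjTranspose_eq_transpose_of_trivial,
      Matrix.transpose_transpose]
  have := quad_nonneg hV Bᵀ
  rw [quad] at this
  rw [h, frob_mul_transpose]
  linarith

/-- T = ½YYᵀ is admissible and is the least admissible matrix, and ⟨V, ·⟩ is monotone in the Löwner
order for V ⪰ 0. -/
theorem infSupport_eq_Phi {n m : ℕ} (𝒱 : Set (Matrix (Fin n) (Fin n) ℝ))
    (Y : Matrix (Fin n) (Fin m) ℝ) : infSupport 𝒱 Y = Phi 𝒱 m Y := by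
  have hq : ∀ V : Matrix (Fin n) (Fin n) ℝ, frob V ((1 / 2 : ℝ) • (Y * Yᵀ)) = quad V Y := by
    intro V
    rw [frob_smul_right, frob_mul_transpose, quad]
  apply le_antisymm
  · refine (iInf₂_le ((1 / 2 : ℝ) • (Y * Yᵀ)) ?_).trans ?_
    · simpa using Matrix.PosSemidef.zero
    · refine iSup₂_le fun V hV => ?_
      rw [hq]
      exact quad_le_Phi hV Y
  · refine le_iInf₂ fun T hT => Phi_le_iff.2 fun V hV => ?_
    refine le_trans ?_ (le_iSup₂ (f := fun V (_ : V ∈ psdPart 𝒱) => (frob V T : EReal)) V hV)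
    have h := frob_nonneg_of_posSemidef hV.2 hT
    rw [frob_sub_right, hq] at h
    exact EReal.coe_le_coe_iff.2 (by linarith)

/-! ### Conjugates and the Fenchel equality -/

theorem fenchel_young {k l : ℕ} {f : Matrix (Fin k) (Fin l) ℝ → EReal} {Y : Matrix (Fin k) (Fin l) ℝ}
    {s : ℝ} (hs : f Y = s) (X : Matrix (Fin k) (Fin l) ℝ) :
    ((frob X Y - s : ℝ) : EReal) ≤ conj f X := by
  rw [EReal.coe_sub, ← hs, frob_comm]
  exact le_iSup (fun Y => (frob Y X : EReal) - f Y) Y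

theorem exists_coe_of_coe_sub {a : EReal} {x r : ℝ} (h : (r : EReal) = x - a) :
    a = ((x - r : ℝ) : EReal) := by
  induction a with
  | bot => simp at h
  | top => simp at h
  | coe a =>
    rw [← EReal.coe_sub, EReal.coe_eq_coe_iff] at h
    rw [EReal.coe_eq_coe_iff]
    linarith

theorem conj_nonneg {k l : ℕ} {f : Matrix (Fin k) (Fin l) ℝ → EReal} (h0 : f 0 = 0)
    (X : Matrix (Fin k) (Fin l) ℝ) : 0 ≤ conj f X := by
  simpa using fenchel_young (s := 0) h0 X

theorem exists_conj_eq_coe {k l : ℕ} {f : Matrix (Fin k) (Fin l) ℝ → EReal} (h0 : f 0 = 0)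
    {X : Matrix (Fin k) (Fin l) ℝ} (hX : X ∈ dom (conj f)) : ∃ r : ℝ, conj f X = r :=
  ⟨_, (EReal.coe_toReal (ne_of_lt hX)
    (ne_of_gt ((EReal.bot_lt_zero).trans_le (conj_nonneg h0 X)))).symm⟩

theorem mem_subdiff_conj_of_eq {k l : ℕ} {f : Matrix (Fin k) (Fin l) ℝ → EReal} (h0 : f 0 = 0)
    {X Y : Matrix (Fin k) (Fin l) ℝ} (hX : X ∈ dom (conj f))
    (h : conj f X = (frob X Y : EReal) - f Y) : Y ∈ subdiff (conj f) X := by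
  refine ⟨hX, fun X' => ?_⟩
  obtain ⟨r, hr⟩ := exists_conj_eq_coe h0 hX
  rw [hr] at h ⊢
  refine le_trans ?_ (fenchel_young (exists_coe_of_coe_sub h) X')
  rw [← EReal.coe_add, EReal.coe_le_coe_iff, frob_sub_right, frob_comm Y, frob_comm Y]
  linarith

/-- If `f` is a supremum of functions `a` such that some `X` satisfies
`a + f*(X) ≤ ⟨X, Y⟩`, then subgradients of `f*` satisfy the Fenchel equality. -/
theorem conj_eq_of_mem_subdiff {k l : ℕ} {f : Matrix (Fin k) (Fin l) ℝ → EReal} (h0 : f 0 = 0)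
    {X Y : Matrix (Fin k) (Fin l) ℝ} (hY : Y ∈ subdiff (conj f) X) (hb : f Y ≠ ⊥)
    (hf : ∀ b : EReal, (∀ X' : Matrix (Fin k) (Fin l) ℝ, ∀ a : ℝ,
      conj f X' ≤ ((frob X' Y - a : ℝ) : EReal) → (a : EReal) ≤ b) → f Y ≤ b) :
    conj f X = (frob X Y : EReal) - f Y := by
  obtain ⟨hX, h⟩ := hY
  obtain ⟨r, hr⟩ := exists_conj_eq_coe h0 hX
  have hle : f Y ≤ ((frob X Y - r : ℝ) : EReal) := by
    refine hf _ fun X' a ha => ?_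
    have h' := (h X').trans ha
    rw [hr, ← EReal.coe_add, EReal.coe_le_coe_iff, frob_sub_right, frob_comm Y, frob_comm Y] at h'
    exact EReal.coe_le_coe_iff.2 (by linarith)
  obtain ⟨s, hs⟩ : ∃ s : ℝ, f Y = s :=
    ⟨_, (EReal.coe_toReal (ne_of_lt (hle.trans_lt (EReal.coe_lt_top _))) hb).symm⟩
  have h2 := fenchel_young hs X
  rw [hs, EReal.coe_le_coe_iff] at hle
  rw [hr, EReal.coe_le_coe_iff] at h2
  rw [hr, hs, ← EReal.coe_sub, EReal.coe_eq_coe_iff]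
  linarith

/-- Φ ≥ q_V gives Φ* ≤ q_V*, and the supremum defining q_V*(VY) is attained at Y. -/
theorem conj_Phi_mul_le {n m : ℕ} {𝒱 : Set (Matrix (Fin n) (Fin n) ℝ)}
    {V : Matrix (Fin n) (Fin n) ℝ} (hV : V ∈ psdPart 𝒱) (Y : Matrix (Fin n) (Fin m) ℝ) :
    conj (Phi 𝒱 m) (V * Y) ≤ ((frob (V * Y) Y - quad V Y : ℝ) : EReal) := by
  refine iSup_le fun Z => ?_
  refine (EReal.sub_le_sub le_rfl (quad_le_Phi hV Z)).trans ?_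
  rw [← EReal.coe_sub, EReal.coe_le_coe_iff]
  have h := frob_mul_le_quad_add_quad hV.2 (psdPart_isSymm hV) Y Z
  rw [frob_comm Z]
  have : frob (V * Y) Y = 2 * quad V Y := by rw [quad]; ring
  linarith

theorem mem_subdiff_conj_Phi_iff {n m : ℕ} {𝒱 : Set (Matrix (Fin n) (Fin n) ℝ)}
    (hne : (psdPart 𝒱).Nonempty) {X Y : Matrix (Fin n) (Fin m) ℝ} :
    Y ∈ subdiff (conj (Phi 𝒱 m)) X ↔
      X ∈ dom (conj (Phi 𝒱 m)) ∧ conj (Phi 𝒱 m) X = (frob X Y : EReal) - Phi 𝒱 m Y := by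
  refine ⟨fun h => ⟨h.1, ?_⟩, fun h => mem_subdiff_conj_of_eq (Phi_zero hne) h.1 h.2⟩
  refine conj_eq_of_mem_subdiff (Phi_zero hne) h
    (ne_of_gt (EReal.bot_lt_zero.trans_le (Phi_nonneg hne Y))) fun b hb => ?_
  exact Phi_le_iff.2 fun V hV => hb (V * Y) (quad V Y) (conj_Phi_mul_le hV Y)

theorem subdiff_conj_Phi_eq_argmax {n m : ℕ} {𝒱 : Set (Matrix (Fin n) (Fin n) ℝ)}
    (hne : (psdPart 𝒱).Nonempty) (X : Matrix (Fin n) (Fin m) ℝ) :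
    subdiff (conj (Phi 𝒱 m)) X =
      argmax fun Y => (frob X Y : EReal) - Phi 𝒱 m Y := by
  ext Y
  rw [mem_subdiff_conj_Phi_iff hne]
  constructor
  · rintro ⟨-, h⟩ Z -
    change (frob X Z : EReal) - Phi 𝒱 m Z ≤ (frob X Y : EReal) - Phi 𝒱 m Y
    rw [← h, frob_comm]
    exact le_iSup (fun Z => (frob Z X : EReal) - Phi 𝒱 m Z) Z
  · intro h
    have heq : conj (Phi 𝒱 m) X = (frob X Y : EReal) - Phi 𝒱 m Y := by
      refine le_antisymm (iSup_le fun Z => ?_) ?_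
      · rw [frob_comm]
        exact h (Set.mem_univ Z)
      · rw [frob_comm]
        exact le_iSup (fun Z => (frob Z X : EReal) - Phi 𝒱 m Z) Y
    refine ⟨?_, heq⟩
    change conj (Phi 𝒱 m) X < ⊤
    rw [heq]
    refine (EReal.sub_le_sub le_rfl (Phi_nonneg hne Y)).trans_lt ?_
    rw [sub_zero]
    exact EReal.coe_lt_top _

/-! ### Attainment of the supremum -/

theorem psdPart_convex {n : ℕ} {𝒱 : Set (Matrix (Fin n) (Fin n) ℝ)} (h : Convex ℝ 𝒱) :
    Convex ℝ (psdPart 𝒱) := by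
  refine h.inter fun V hV W hW a b ha hb _ => ?_
  exact (hV.smul ha).add (hW.smul hb)

/-- A convex set of positive semidefinite matrices has an element whose kernel is contained
in the kernel of all other elements. -/
theorem exists_ker_le {n : ℕ} {S : Set (Matrix (Fin n) (Fin n) ℝ)} (hS : Convex ℝ S)
    (hpsd : ∀ V ∈ S, V.PosSemidef) (hne : S.Nonempty) :
    ∃ V₀ ∈ S, ∀ V ∈ S, LinearMap.ker V₀.mulVecLin ≤ LinearMap.ker V.mulVecLin := by
  let d : Matrix (Fin n) (Fin n) ℝ → ℕ := fun V => Module.finrank ℝ (LinearMap.ker V.mulVecLin)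
  obtain ⟨V₀, hV₀, hmin⟩ := (InvImage.wf d wellFounded_lt).has_min S hne
  refine ⟨V₀, hV₀, fun V hV => ?_⟩
  -- `V₀` minimizes the kernel dimension. The kernel of a midpoint of two positive semidefinite
  -- matrices is the intersection of their kernels, so it cannot be smaller than that of `V₀`.
  have hW : (1 / 2 : ℝ) • V₀ + (1 / 2 : ℝ) • V ∈ S :=
    hS hV₀ hV (by norm_num) (by norm_num) (by norm_num)
  have hker : ∀ x, ((1 / 2 : ℝ) • V₀ + (1 / 2 : ℝ) • V) *ᵥ x = 0 → V₀ *ᵥ x = 0 ∧ V *ᵥ x = 0 := by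
    intro x hx
    have h0 := (hpsd V₀ hV₀).dotProduct_mulVec_nonneg x
    have h1 := (hpsd V hV).dotProduct_mulVec_nonneg x
    have h2 := congrArg (star x ⬝ᵥ ·) hx
    simp only [Matrix.add_mulVec, Matrix.smul_mulVec, dotProduct_add, dotProduct_smul,
      smul_eq_mul, dotProduct_zero] at h2
    exact ⟨((hpsd V₀ hV₀).dotProduct_mulVec_zero_iff x).1 (by linarith),
      ((hpsd V hV).dotProduct_mulVec_zero_iff x).1 (by linarith)⟩
  have hle : LinearMap.ker ((1 / 2 : ℝ) • V₀ + (1 / 2 : ℝ) • V).mulVecLin ≤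
      LinearMap.ker V₀.mulVecLin := fun x hx => (hker x hx).1
  rw [← Submodule.eq_of_le_of_finrank_le hle (not_lt.1 (hmin _ hW))]
  exact fun x hx => (hker x hx).2

theorem mul_eq_zero_of_ker_le {n m : ℕ} {V W : Matrix (Fin n) (Fin n) ℝ}
    (h : LinearMap.ker V.mulVecLin ≤ LinearMap.ker W.mulVecLin) {Z : Matrix (Fin n) (Fin m) ℝ}
    (hZ : V * Z = 0) : W * Z = 0 := by
  ext i j
  have hx : Z.col j ∈ LinearMap.ker V.mulVecLin := by
    ext i
    exact congrFun (congrFun hZ i) j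
  exact congrFun (h hx) i

theorem quad_congr {n m : ℕ} {V : Matrix (Fin n) (Fin n) ℝ} (hV : V.IsSymm)
    {Y Z : Matrix (Fin n) (Fin m) ℝ} (h : V * Y = V * Z) : quad V Y = quad V Z := by
  rw [quad, quad, h, frob_mul_left, hV.eq, h, frob_comm]

theorem lowerSemicontinuous_Phi_sub {n m : ℕ} (𝒱 : Set (Matrix (Fin n) (Fin n) ℝ))
    (X : Matrix (Fin n) (Fin m) ℝ) :
    LowerSemicontinuous fun Y => Phi 𝒱 m Y - (frob X Y : EReal) := by
  have h : (fun Y => Phi 𝒱 m Y - (frob X Y : EReal)) =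
      fun Y => ⨆ V ∈ psdPart 𝒱, ((quad V Y - frob X Y : ℝ) : EReal) := by
    funext Y
    refine eq_of_forall_ge_iff fun a => ?_
    rw [iSup₂_le_iff, EReal.sub_le_iff_le_add (by simp) (by simp), Phi_le_iff]
    refine forall₂_congr fun V _ => ?_
    rw [EReal.coe_sub, EReal.sub_le_iff_le_add (by simp) (by simp)]
  rw [h]
  refine lowerSemicontinuous_biSup fun V _ => Continuous.lowerSemicontinuous ?_
  exact continuous_coe_real_ereal.comp
    ((continuous_quad continuous_const continuous_id).sub
      (continuous_frob continuous_const continuous_id))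

theorem subdiff_conj_Phi_nonempty {n m : ℕ} {𝒱 : Set (Matrix (Fin n) (Fin n) ℝ)}
    (hconvex : Convex ℝ 𝒱) (hne : (psdPart 𝒱).Nonempty) {X : Matrix (Fin n) (Fin m) ℝ}
    (hX : X ∈ dom (conj (Phi 𝒱 m))) : (subdiff (conj (Phi 𝒱 m)) X).Nonempty := by
  obtain ⟨V₀, hV₀, hker⟩ := exists_ker_le (psdPart_convex hconvex) (fun V hV => hV.2) hne
  obtain ⟨P, hP, hPt⟩ := exists_isMoorePenrose_of_isHermitian hV₀.2.isHermitian
  -- P V₀ = V₀ P is the orthogonal projector onto the range of `V₀`.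
  have hcomm : V₀ * P = P * V₀ := by
    rw [← hP.symm_left, Matrix.transpose_mul, hPt, (psdPart_isSymm hV₀).eq]
  have hkill : ∀ Y : Matrix (Fin n) (Fin m) ℝ, ∀ V ∈ psdPart 𝒱, V * (Y - P * V₀ * Y) = 0 := by
    intro Y V hV
    refine mul_eq_zero_of_ker_le (hker V hV) ?_
    rw [Matrix.mul_sub, ← Matrix.mul_assoc, ← Matrix.mul_assoc, hP.mul_mul_left, sub_self]
  have hΦ : ∀ Y : Matrix (Fin n) (Fin m) ℝ, Phi 𝒱 m (P * V₀ * Y) = Phi 𝒱 m Y := by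
    intro Y
    refine eq_of_forall_ge_iff fun a => ?_
    rw [Phi_le_iff, Phi_le_iff]
    refine forall₂_congr fun V hV => ?_
    have h := hkill Y V hV
    rw [Matrix.mul_sub, sub_eq_zero] at h
    rw [quad_congr (psdPart_isSymm hV) h]
  have hsymm : ∀ Y Z : Matrix (Fin n) (Fin m) ℝ, frob (P * V₀ * Y) Z = frob Y (P * V₀ * Z) := by
    intro Y Z
    rw [frob_mul_left, hP.symm_right]
  -- Φ vanishes along the line spanned by the kernel component N of X, while ⟨X, tN⟩ = t‖N‖² is
  -- unbounded in t unless N = 0.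
  have hXP : X = P * V₀ * X := by
    rw [← sub_eq_zero]
    set N := X - P * V₀ * X with hN
    apply eq_zero_of_frob_self_nonpos
    have hNN : frob N X = frob N N := by
      have h0 : P * V₀ * N = 0 := by
        rw [Matrix.mul_assoc, hkill X V₀ hV₀, Matrix.mul_zero]
      have h1 : frob N (P * V₀ * X) = 0 := by
        rw [← hsymm, h0, frob_zero_left]
      nth_rw 3 [hN]
      rw [frob_sub_right, h1, sub_zero]
    obtain ⟨r, hr⟩ := exists_conj_eq_coe (Phi_zero hne) hX
    have hbound : ∀ t : ℝ, t * frob N N ≤ r := by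
      intro t
      have hz : Phi 𝒱 m (t • N) = ((0 : ℝ) : EReal) := by
        refine le_antisymm (Phi_le_iff.2 fun V hV => ?_) (Phi_nonneg hne _)
        rw [quad, Matrix.mul_smul, hkill X V hV]
        simp
      have h := fenchel_young hz X
      rwa [hr, EReal.coe_le_coe_iff, sub_zero, frob_comm, frob_smul_left, hNN] at h
    by_contra! hpos
    have h := hbound ((r + 1) / frob N N)
    rw [div_mul_cancel₀ _ hpos.ne'] at h
    linarith
  obtain ⟨B, hB⟩ := hV₀.2.exists_eq_star_mul_self
  rw [Matrix.star_eq_conjTranspose, Matrix.conjTranspose_eq_transpose_of_trivial] at hB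
  -- If Φ(Y) ≤ ⟨X, Y⟩, then q(Y) ≤ ⟨X, Y⟩ for q = q_{V₀}, and Fenchel-Young at 2PX gives 2⟨X, Y⟩ ≤
  -- 4q(PX) + q(Y). Hence ‖BY‖² = 2q(Y) ≤ 8q(PX).
  set R := 8 * quad V₀ (P * X) with hR
  have hR0 : 0 ≤ R := mul_nonneg (by norm_num) (quad_nonneg hV₀.2 _)
  set K : Set (Matrix (Fin n) (Fin m) ℝ) := (fun W => P * Bᵀ * W) '' {W | frob W W ≤ R} with hK
  have hKc : IsCompact K := (isCompact_frob_self_le n m R).image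
    (continuous_const.matrix_mul continuous_id)
  have h0K : (0 : Matrix (Fin n) (Fin m) ℝ) ∈ K := ⟨0, by simpa using hR0, Matrix.mul_zero _⟩
  obtain ⟨Y₀, -, hmin⟩ := LowerSemicontinuousOn.exists_isMinOn ⟨0, h0K⟩ hKc
    ((lowerSemicontinuous_Phi_sub 𝒱 X).lowerSemicontinuousOn K)
  rw [isMinOn_iff] at hmin
  have hle0 : Phi 𝒱 m Y₀ - (frob X Y₀ : EReal) ≤ 0 := by
    simpa [Phi_zero hne] using hmin 0 h0K
  -- Where the objective is nonnegative, 0 ∈ K does at least as well; otherwise the projection P V₀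
  -- Y = P Bᵀ(BY) lies in K and has the same objective value.
  have hglobal : ∀ Y, Phi 𝒱 m Y₀ - (frob X Y₀ : EReal) ≤ Phi 𝒱 m Y - (frob X Y : EReal) := by
    intro Y
    rcases le_total 0 (Phi 𝒱 m Y - (frob X Y : EReal)) with h | h
    · exact hle0.trans h
    have hq : quad V₀ Y ≤ frob X Y := by
      rw [EReal.sub_nonpos] at h
      exact EReal.coe_le_coe_iff.1 ((quad_le_Phi hV₀ Y).trans h)
    have hXY : frob X Y = frob (V₀ * (P * X)) Y := by
      rw [← Matrix.mul_assoc, hcomm, ← hXP]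
    have h2 := frob_mul_le_quad_add_quad hV₀.2 (psdPart_isSymm hV₀) ((2 : ℝ) • (P * X)) Y
    have h3 : quad V₀ ((2 : ℝ) • (P * X)) = 4 * quad V₀ (P * X) := by
      simp only [quad, Matrix.mul_smul, frob_smul_left, frob_smul_right]
      ring
    rw [h3, Matrix.mul_smul, frob_smul_left, ← hXY] at h2
    have h4 : frob (B * Y) (B * Y) = 2 * quad V₀ Y := by
      rw [frob_mul_left, ← Matrix.mul_assoc, ← hB, frob_comm, quad]
      ring
    have hmem : P * V₀ * Y ∈ K := by
      refine ⟨B * Y, ?_, ?_⟩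
      · change frob (B * Y) (B * Y) ≤ R
        linarith
      · rw [hB, Matrix.mul_assoc P, Matrix.mul_assoc Bᵀ, ← Matrix.mul_assoc P]
        exact (Matrix.mul_assoc _ _ _).trans (Matrix.mul_assoc _ _ _).symm
    have h5 := hmin _ hmem
    rwa [hΦ, ← hsymm, ← hXP] at h5
  obtain ⟨s, hs⟩ : ∃ s : ℝ, Phi 𝒱 m Y₀ = s := by
    refine ⟨_, (EReal.coe_toReal (ne_of_lt ?_)
      (ne_of_gt (EReal.bot_lt_zero.trans_le (Phi_nonneg hne Y₀)))).symm⟩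
    exact (EReal.sub_nonpos.1 hle0).trans_lt (EReal.coe_lt_top _)
  refine ⟨Y₀, ?_⟩
  rw [subdiff_conj_Phi_eq_argmax hne]
  intro Y _
  change (frob X Y : EReal) - Phi 𝒱 m Y ≤ (frob X Y₀ : EReal) - Phi 𝒱 m Y₀
  have h := hglobal Y
  have hn := Phi_nonneg hne Y
  rw [hs] at h ⊢
  induction hp : Phi 𝒱 m Y with
  | bot => rw [hp] at hn; simp at hn
  | top => simp
  | coe a =>
    rw [hp, ← EReal.coe_sub, ← EReal.coe_sub, EReal.coe_le_coe_iff] at h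
    rw [← EReal.coe_sub, ← EReal.coe_sub, EReal.coe_le_coe_iff]
    linarith

theorem domSubdiff_conj_Phi {n : ℕ} (m : ℕ) {𝒱 : Set (Matrix (Fin n) (Fin n) ℝ)}
    (hconvex : Convex ℝ 𝒱) (hne : (psdPart 𝒱).Nonempty) :
    domSubdiff (conj (Phi 𝒱 m)) = dom (conj (Phi 𝒱 m)) :=
  Set.Subset.antisymm (fun _ ⟨_, h⟩ => h.1) fun _ hX => subdiff_conj_Phi_nonempty hconvex hne hX

/-! ### Subgradients of a maximum over a compact set -/

/-- Separation of a matrix from a closed convex set by a linear functional `⟨·, D⟩`. -/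
theorem exists_frob_separation {k l : ℕ} {C : Set (Matrix (Fin k) (Fin l) ℝ)} (hC : Convex ℝ C)
    (hcl : IsClosed C) {X : Matrix (Fin k) (Fin l) ℝ} (hX : X ∉ C) :
    ∃ (D : Matrix (Fin k) (Fin l) ℝ) (u : ℝ), (∀ Z ∈ C, frob Z D < u) ∧ u < frob X D := by
  have hcl : IsClosed (X := Fin k → Fin l → ℝ) C := hcl
  obtain ⟨f, u, h1, h2⟩ := geometric_hahn_banach_closed_point (E := Fin k → Fin l → ℝ)
    (s := C) (x := X) hC hcl hX
  let D : Matrix (Fin k) (Fin l) ℝ := fun i j => f (Pi.single i (Pi.single j 1))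
  have hf : ∀ Z : Fin k → Fin l → ℝ, f Z = ∑ i, ∑ j, Z i j * f (Pi.single i (Pi.single j 1)) := by
    intro Z
    have hZ : Z = ∑ i, ∑ j, Z i j • Pi.single i (Pi.single j (1 : ℝ)) := by
      ext a b
      simp [Finset.sum_apply, Pi.single_apply, ite_apply]
    conv_lhs => rw [hZ]
    simp only [map_sum, map_smul, smul_eq_mul]
  have hD : ∀ Z : Matrix (Fin k) (Fin l) ℝ, frob Z D = f Z :=
    fun Z => (frob_eq_sum Z D).trans (hf Z).symm
  exact ⟨D, u, fun Z hZ => (hD Z).trans_lt (h1 Z hZ), h2.trans_eq (hD X).symm⟩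

theorem exists_quad_le_of_isCompact {n m : ℕ} {S : Set (Matrix (Fin n) (Fin n) ℝ)} (hS : IsCompact S)
    (D : Matrix (Fin n) (Fin m) ℝ) : ∃ M : ℝ, ∀ V ∈ S, quad V D ≤ M := by
  obtain ⟨M, hM⟩ := (hS.image_of_continuousOn
    (continuous_quad continuous_id continuous_const (g := fun _ => D)).continuousOn).bddAbove
  exact ⟨M, fun V hV => hM ⟨V, hV, rfl⟩⟩

/-- Subgradients of a supremum of positive semidefinite quadratic forms over a compact convex
set at `Y` are of the form `V Y` with `V` active at `Y`. -/
theorem exists_active_eq_mul {n m : ℕ} {S : Set (Matrix (Fin n) (Fin n) ℝ)} (hS : Convex ℝ S)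
    (hcomp : IsCompact S) (hsymm : ∀ V ∈ S, V.IsSymm) {X Y : Matrix (Fin n) (Fin m) ℝ} {φ : ℝ}
    (hφ : ∀ V ∈ S, quad V Y ≤ φ)
    (hsub : ∀ Z : Matrix (Fin n) (Fin m) ℝ, ∃ V ∈ S, φ + frob X (Z - Y) ≤ quad V Z) :
    ∃ V ∈ S, quad V Y = φ ∧ X = V * Y := by
  have cquad : Continuous fun V : Matrix (Fin n) (Fin n) ℝ => quad V Y :=
    continuous_quad continuous_id continuous_const
  set A : Set (Matrix (Fin n) (Fin n) ℝ) := S ∩ {V | φ ≤ quad V Y} with hA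
  have hAcomp : IsCompact A := hcomp.inter_right (isClosed_le continuous_const cquad)
  have hAconv : Convex ℝ A := by
    refine hS.inter fun V hV W hW a b ha hb hab => ?_
    have h : quad (a • V + b • W) Y = a * quad V Y + b * quad W Y := by
      simp only [quad, Matrix.add_mul, Matrix.smul_mul, frob_add_left, frob_smul_left]
      ring
    change φ ≤ quad (a • V + b • W) Y
    rw [h]
    calc φ = a * φ + b * φ := by rw [← add_mul, hab, one_mul]
      _ ≤ _ := add_le_add (mul_le_mul_of_nonneg_left hV ha) (mul_le_mul_of_nonneg_left hW hb)
  -- Otherwise a direction D strictly separates X from the compact convex set of all VY with V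
  -- active. Moving from Y to Y + tD and letting t → 0 yields an active V with ⟨VY, D⟩ ≥ ⟨X, D⟩, a
  -- contradiction.
  by_contra! hcon
  have hX : X ∉ (fun V => V * Y) '' A := by
    rintro ⟨V, hV, rfl⟩
    exact hcon V hV.1 (le_antisymm (hφ V hV.1) hV.2) rfl
  have hconv : Convex ℝ ((fun V => V * Y) '' A) := by
    rintro _ ⟨V, hV, rfl⟩ _ ⟨W, hW, rfl⟩ a b ha hb hab
    exact ⟨a • V + b • W, hAconv hV hW ha hb hab, by
      simp only [Matrix.add_mul, Matrix.smul_mul]⟩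
  obtain ⟨D, u, hD, hu⟩ := exists_frob_separation hconv
    (hAcomp.image (continuous_id.matrix_mul continuous_const)).isClosed hX
  have cfrob : Continuous fun V : Matrix (Fin n) (Fin n) ℝ => frob (V * Y) D :=
    continuous_frob (continuous_id.matrix_mul continuous_const) continuous_const
  obtain ⟨M₁, hM₁⟩ := exists_quad_le_of_isCompact hcomp D
  obtain ⟨M₂, hM₂⟩ := (hcomp.image cfrob).bddAbove
  have hM₂ : ∀ V ∈ S, frob (V * Y) D ≤ M₂ := fun V hV => hM₂ ⟨V, hV, rfl⟩
  set M := |M₁| + |M₂| + |frob X D| with hM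
  let t : ℕ → ℝ := fun k => 1 / ((k : ℝ) + 1)
  have ht0 : ∀ k, 0 < t k := fun k => Nat.one_div_pos_of_nat
  have ht1 : ∀ k, t k ≤ 1 := fun k => by
    simpa [t] using Nat.one_div_le_one_div (α := ℝ) (Nat.zero_le k)
  have hM0 : 0 ≤ M := by positivity
  -- Activity and the slope inequality, both relaxed by t M: nested compact sets whose common point
  -- satisfies them exactly.
  let K : ℕ → Set (Matrix (Fin n) (Fin n) ℝ) := fun k =>
    S ∩ {V | φ - t k * M ≤ quad V Y ∧ frob X D - t k * M ≤ frob (V * Y) D}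
  have hKcl : ∀ k, IsClosed (K k) := fun k => hcomp.isClosed.inter
    ((isClosed_le continuous_const cquad).inter (isClosed_le continuous_const cfrob))
  -- In φ + t⟨X, D⟩ ≤ q_V(Y) + t⟨VY, D⟩ + t² q_V(D), bounding the terms in t with t ≤ 1 gives
  -- near-activity; using q_V(Y) ≤ φ and dividing by t gives the near-slope bound.
  have hKne : ∀ k, (K k).Nonempty := by
    intro k
    obtain ⟨V, hV, h⟩ := hsub (Y + t k • D)
    rw [add_sub_cancel_left, frob_smul_right, quad_add_smul (hsymm V hV)] at h
    have hq : t k ^ 2 * quad V D ≤ t k * (t k * |M₁|) := by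
      rw [sq, mul_assoc]
      have := (hM₁ V hV).trans (le_abs_self M₁)
      have := ht0 k
      gcongr
    have hq1 : t k * |M₁| ≤ |M₁| := mul_le_of_le_one_left (abs_nonneg _) (ht1 k)
    refine ⟨V, hV, ?_, ?_⟩
    · have h1 : t k * frob (V * Y) D ≤ t k * |M₂| :=
        mul_le_mul_of_nonneg_left ((hM₂ V hV).trans (le_abs_self _)) (ht0 k).le
      have h2 : t k * -|frob X D| ≤ t k * frob X D :=
        mul_le_mul_of_nonneg_left (neg_abs_le _) (ht0 k).le
      have h3 : t k * (t k * |M₁|) ≤ t k * |M₁| := mul_le_mul_of_nonneg_left hq1 (ht0 k).le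
      rw [hM]
      linarith
    · have h1 := hφ V hV
      have h2 : t k * (frob X D - t k * |M₁|) ≤ t k * frob (V * Y) D := by linarith
      have h3 := le_of_mul_le_mul_left h2 (ht0 k)
      have h4 : t k * |M₁| ≤ t k * M := by
        refine mul_le_mul_of_nonneg_left ?_ (ht0 k).le
        have := abs_nonneg M₂
        have := abs_nonneg (frob X D)
        linarith
      linarith
  have hanti : ∀ k, K (k + 1) ⊆ K k := by
    rintro k V ⟨hV, h1, h2⟩
    have h : t (k + 1) * M ≤ t k * M :=
      mul_le_mul_of_nonneg_right (Nat.one_div_le_one_div (Nat.le_succ k)) hM0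
    exact ⟨hV, by linarith, by linarith⟩
  obtain ⟨V, hV⟩ := IsCompact.nonempty_iInter_of_sequence_nonempty_isCompact_isClosed K hanti hKne
    (hcomp.of_isClosed_subset (hKcl 0) Set.inter_subset_left) hKcl
  rw [Set.mem_iInter] at hV
  have hlim : ∀ a : ℝ, Filter.Tendsto (fun k => a - t k * M) Filter.atTop (nhds a) := by
    intro a
    simpa [t] using (tendsto_one_div_add_atTop_nhds_zero_nat.mul_const M).const_sub a
  have hVA : V ∈ A := ⟨(hV 0).1, le_of_tendsto' (hlim φ) fun k => (hV k).2.1⟩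
  have h1 := hD _ ⟨V, hVA, rfl⟩
  have h2 : frob X D ≤ frob (V * Y) D := le_of_tendsto' (hlim _) fun k => (hV k).2.2
  linarith

/-! ### The bounded case and the conclusion -/

theorem psdPart_isCompact {n : ℕ} {𝒱 : Set (Matrix (Fin n) (Fin n) ℝ)} (hcl : IsClosed 𝒱)
    (hb : FrobBounded (psdPart 𝒱)) : IsCompact (psdPart 𝒱) := by
  obtain ⟨C, hC⟩ := hb
  have hpsd : {V : Matrix (Fin n) (Fin n) ℝ | V.PosSemidef} =
      {V | Vᵀ = V} ∩ ⋂ x : Fin n → ℝ, {V | 0 ≤ x ⬝ᵥ V *ᵥ x} := by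
    ext V
    simp [Matrix.posSemidef_iff_dotProduct_mulVec, Matrix.IsHermitian,
      Matrix.conjTranspose_eq_transpose_of_trivial]
  have hclosed : IsClosed (psdPart 𝒱) := by
    refine hcl.inter ?_
    rw [hpsd]
    refine (isClosed_eq continuous_id.matrix_transpose continuous_id).inter
      (isClosed_iInter fun x => isClosed_le continuous_const ?_)
    exact continuous_const.dotProduct (continuous_id.matrix_mulVec continuous_const)
  refine (isCompact_frob_self_le n n (C ^ 2)).of_isClosed_subset hclosed fun V hV => ?_
  exact (Real.sqrt_le_left ((Real.sqrt_nonneg _).trans (hC V hV))).1 (hC V hV)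

theorem exists_Phi_eq_quad {n m : ℕ} {𝒱 : Set (Matrix (Fin n) (Fin n) ℝ)}
    (hne : (psdPart 𝒱).Nonempty) (hcomp : IsCompact (psdPart 𝒱)) (Y : Matrix (Fin n) (Fin m) ℝ) :
    ∃ V ∈ psdPart 𝒱, Phi 𝒱 m Y = (quad V Y : EReal) := by
  obtain ⟨V, hV, hmax⟩ := hcomp.exists_isMaxOn hne
    (continuous_quad continuous_id (continuous_const (y := Y))).continuousOn
  exact ⟨V, hV, le_antisymm
    (Phi_le_iff.2 fun W hW => EReal.coe_le_coe_iff.2 (hmax hW)) (quad_le_Phi hV Y)⟩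

theorem subdiff_conj_Phi_eq_of_isCompact {n m : ℕ} {𝒱 : Set (Matrix (Fin n) (Fin n) ℝ)}
    (hconvex : Convex ℝ (psdPart 𝒱)) (hne : (psdPart 𝒱).Nonempty)
    (hcomp : IsCompact (psdPart 𝒱)) {X : Matrix (Fin n) (Fin m) ℝ}
    (hX : X ∈ dom (conj (Phi 𝒱 m))) :
    subdiff (conj (Phi 𝒱 m)) X =
      {Y | ∃ V ∈ psdPart 𝒱, rge X ≤ rge V ∧
        conj (Phi 𝒱 m) X = (((1 / 2 : ℝ) * (Xᵀ * pinv V * X).trace : ℝ) : EReal) ∧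
        (((1 / 2 : ℝ) * (Xᵀ * pinv V * X).trace : ℝ) : EReal) =
          (frob X Y : EReal) - Phi 𝒱 m Y} := by
  ext Y
  rw [mem_subdiff_conj_Phi_iff hne]
  constructor
  · rintro ⟨-, hXY⟩
    obtain ⟨V₀, -, hV₀⟩ := exists_Phi_eq_quad hne hcomp Y
    obtain ⟨V, hV, hact, rfl⟩ := exists_active_eq_mul (X := X) (Y := Y) (φ := quad V₀ Y) hconvex
      hcomp (fun V hV => psdPart_isSymm hV)
      (fun V hV => EReal.coe_le_coe_iff.1 (hV₀ ▸ quad_le_Phi hV Y)) fun Z => by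
        obtain ⟨W, hW, hZ⟩ := exists_Phi_eq_quad hne hcomp Z
        refine ⟨W, hW, ?_⟩
        have h := fenchel_young hZ X
        rw [hXY, hV₀, ← EReal.coe_sub, EReal.coe_le_coe_iff] at h
        rw [frob_sub_right]
        linarith
    have htr : (1 / 2 : ℝ) * ((V * Y)ᵀ * pinv V * (V * Y)).trace = quad V Y := by
      have h : (V * Y)ᵀ * pinv V * (V * Y) = (V * Y)ᵀ * Y := by
        rw [Matrix.transpose_mul, (psdPart_isSymm hV).eq]
        calc Yᵀ * V * pinv V * (V * Y) = Yᵀ * (V * pinv V * V) * Y := by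
              simp only [Matrix.mul_assoc]
          _ = _ := by rw [(pinv_spec V).mul_mul_left]
      rw [h, quad, frob]
    have heq : ((quad V Y : ℝ) : EReal) = (frob (V * Y) Y : EReal) - Phi 𝒱 m Y := by
      rw [hV₀, ← hact, ← EReal.coe_sub, EReal.coe_eq_coe_iff, quad]
      ring
    refine ⟨V, hV, ?_, ?_, ?_⟩
    · rw [rge, rge, Matrix.mulVecLin_mul]
      exact LinearMap.range_comp_le_range _ _
    · rw [htr, heq, hXY]
    · rw [htr, heq]
  · rintro ⟨V, -, -, h1, h2⟩
    exact ⟨hX, h1.trans h2⟩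

end VGF

theorem mainTheorem10 (n m : ℕ) (𝒱 : Set (Matrix (Fin n) (Fin n) ℝ))
    (hsymm : ∀ V ∈ 𝒱, V.IsSymm) (hclosed : IsClosed 𝒱) (hconvex : Convex ℝ 𝒱) :
    ((∃ V ∈ 𝒱, V.PosDef) →
      VGF.domSubdiff (VGF.conj (VGF.Phi 𝒱 m)) = VGF.dom (VGF.conj (VGF.Phi 𝒱 m)) ∧
      ∀ X : Matrix (Fin n) (Fin m) ℝ,
        VGF.subdiff (VGF.conj (VGF.Phi 𝒱 m)) X =
          VGF.argmax fun Y => (VGF.frob X Y : EReal) - VGF.infSupport 𝒱 Y) ∧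
    ((VGF.psdPart 𝒱).Nonempty → VGF.FrobBounded (VGF.psdPart 𝒱) →
      VGF.domSubdiff (VGF.conj (VGF.Phi 𝒱 m)) = VGF.dom (VGF.conj (VGF.Phi 𝒱 m)) ∧
      ∀ X ∈ VGF.dom (VGF.conj (VGF.Phi 𝒱 m)),
        VGF.subdiff (VGF.conj (VGF.Phi 𝒱 m)) X =
          {Y | ∃ V ∈ VGF.psdPart 𝒱, VGF.rge X ≤ VGF.rge V ∧
            VGF.conj (VGF.Phi 𝒱 m) X =
              (((1 / 2 : ℝ) * (X.transpose * VGF.pinv V * X).trace : ℝ) : EReal) ∧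
            (((1 / 2 : ℝ) * (X.transpose * VGF.pinv V * X).trace : ℝ) : EReal) =
              (VGF.frob X Y : EReal) - VGF.Phi 𝒱 m Y}) := by
  refine ⟨fun ⟨V, hV, hpos⟩ => ?_, fun hne hb => ⟨VGF.domSubdiff_conj_Phi m hconvex hne, ?_⟩⟩
  · have hne : (VGF.psdPart 𝒱).Nonempty := ⟨V, hV, hpos.posSemidef⟩
    refine ⟨VGF.domSubdiff_conj_Phi m hconvex hne, fun X => ?_⟩
    simp only [VGF.infSupport_eq_Phi]
    exact VGF.subdiff_conj_Phi_eq_argmax hne X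
  · intro X hX
    exact VGF.subdiff_conj_Phi_eq_of_isCompact (VGF.psdPart_convex hconvex) hne
      (VGF.psdPart_isCompact hclosed hb) hX
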